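/- Let $N\ge 1$, $m>0$, $K>0$ and $\Omega\in\mathbb R^N$ with $\frac1N\sum_{i=1}^N\Omega_i=0$. Consider the Kuramoto model with inertia $$m\ddot\theta_i+\dot\theta_i=\Omega_i+\frac KN\sum_{j=1}^N\sin(\theta_j-\theta_i),\quad t>0,\qquad (\theta_i,\dot\theta_i)(0)=(\theta_{i0},\omega_{i0}),\qquad i=1,\dots,N,$$ with real-valued phases. For $x\in\mathbb R^N$ write $D(x)=\max_{i,j}|x_i-x_j|$ and $x_c=\frac1N\sum_i x_i$. A phase-locked state is an equilibrium, i.e. a $\theta\in\mathbb R^N$ with $\Omega_i+\frac KN\sum_{j}\sin(\theta_j-\theta_i)=0$ for all $i$; it emerges from the initial data $(\theta_0,\omega_0)\in\mathbb R^N\times\mathbb R^N$ if the solution $\theta(t)$ with these data converges to it as $t\to\infty$. (a) Phase-locked states with diameter less than $\frac\pi2$ are unique up to a phase shift: if $\theta,\tilde\theta$ are phase-locked states with $D(\theta),D(\tilde\theta)<\frac\pi2$, then $\theta-\tilde\theta=\beta\,(1,\dots,1)$ for some $\beta\in\mathbb R$. (b) If $\theta^\infty$ and $\tilde\theta^\infty$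 are phase-locked states that emerge from initial data $(\theta_0,\omega_0)$ and $(\tilde\theta_0,\tilde\omega_0)$, respectively, and $D(\theta^\infty),D(\tilde\theta^\infty)<\frac\pi2$, then $$\theta^\infty-\tilde\theta^\infty=\Big(\theta_c(0)-\tilde\theta_c(0)+m\big(\omega_c(0)-\tilde\omega_c(0)\big)\Big)(1,\dots,1),$$ where $\theta_c(0),\tilde\theta_c(0),\omega_c(0),\tilde\omega_c(0)$ are the averages of $\theta_0,\tilde\theta_0,\omega_0,\tilde\omega_0$. -/

import Mathlib

namespace Kuramoto

noncomputable section

/-- The diameter `max_{i,j} |x_i - x_j|` of a configuration; for `0 < N` this supremum runs over a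
finite nonempty set, so it is a maximum. -/
def diam {N : ℕ} (x : Fin N → ℝ) : ℝ :=
  ⨆ p : Fin N × Fin N, |x p.1 - x p.2|

/-- The average (macro variable) `x_c = (1/N) ∑ x_i`. -/
def mean {N : ℕ} (x : Fin N → ℝ) : ℝ :=
  (1 / (N : ℝ)) * ∑ i, x i

/-- The right-hand side `Ω_i + (K/N) ∑_j sin (θ_j - θ_i)` of the Kuramoto model. -/
def force {N : ℕ} (K : ℝ) (Ω θ : Fin N → ℝ) (i : Fin N) : ℝ :=
  Ω i + (K / (N : ℝ)) * ∑ j, Real.sin (θ j - θ i)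

/-- `θ` is a classical solution on `[0, ∞)`, with frequencies `ω = θ'`, of
`m θ_i'' + θ_i' = Ω_i + (K/N) ∑_j sin (θ_j - θ_i)` for `t > 0`, with initial data
`(θ, θ') (0) = (θ₀, ω₀)`. It is written as a first-order system in `(θ, ω)`; continuity of `θ` and
`ω` up to `t = 0` makes `ω 0` the right derivative of `θ` at `0`. Phases are real numbers
(lifts of points of the torus). Values at negative times are irrelevant. -/
structure IsSolution {N : ℕ} (m K : ℝ) (Ω θ₀ ω₀ : Fin N → ℝ) (θ ω : ℝ → Fin N → ℝ) : Prop where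
  continuousOn_phase : ContinuousOn θ (Set.Ici 0)
  continuousOn_freq : ContinuousOn ω (Set.Ici 0)
  phase_zero : θ 0 = θ₀
  freq_zero : ω 0 = ω₀
  hasDerivAt_phase : ∀ t : ℝ, 0 < t → ∀ i, HasDerivAt (fun s => θ s i) (ω t i) t
  hasDerivAt_freq : ∀ t : ℝ, 0 < t → ∀ i,
    HasDerivAt (fun s => ω s i) ((1 / m) * (-ω t i + force K Ω (θ t) i)) t

/-- Phase-locked states: equilibria of the model. -/
def IsPhaseLocked {N : ℕ} (K : ℝ) (Ω θ : Fin N → ℝ) : Prop :=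
  ∀ i, force K Ω θ i = 0

/-- Two configurations are congruent if they differ by a uniform phase shift. -/
def Congruent {N : ℕ} (θ θ' : Fin N → ℝ) : Prop :=
  ∃ β : ℝ, θ - θ' = fun _ => β

/-- `θinf` is a phase-locked state that emerges from the initial data `(θ₀, ω₀)`: it is the limit
as `t → ∞` of the solution with these data. -/
def EmergesFrom {N : ℕ} (m K : ℝ) (Ω θ₀ ω₀ θinf : Fin N → ℝ) : Prop :=
  IsPhaseLocked K Ω θinf ∧
    ∃ θ ω : ℝ → Fin N → ℝ, IsSolution m K Ω θ₀ ω₀ θ ω ∧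
      Filter.Tendsto θ Filter.atTop (nhds θinf)

end

end Kuramoto

namespace Kuramoto

/-! For two locked states let `d i = θ i - θ' i`, and let `s i j` be the difference of their sine
interactions. Equilibrium makes the rows of `s` sum to zero; with antisymmetry, `∑ (d j - d i) * s i
j = 0`. Sine is strictly increasing on (-π/2, π/2), so every term is nonnegative and `d` is
constant. The shift comes from averages: summing the equations cancels `Ω` and the sines, so `m ∑ ω
+ ∑ θ` is conserved, and `∑ θ` relaxes to that constant. -/

lemma abs_sub_le_diam {N : ℕ} (x : Fin N → ℝ) (i j : Fin N) : |x i - x j| ≤ diam x :=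
  le_ciSup (f := fun p : Fin N × Fin N => |x p.1 - x p.2|) (Set.finite_range _).bddAbove (i, j)

/-- The sine interactions cancel pairwise. -/
lemma sum_sum_sin_sub {ι : Type*} [Fintype ι] (θ : ι → ℝ) :
    ∑ i, ∑ j, Real.sin (θ j - θ i) = 0 := by
  have h : ∑ i, ∑ j, Real.sin (θ j - θ i) = -∑ i, ∑ j, Real.sin (θ j - θ i) := by
    conv_lhs => rw [Finset.sum_comm]
    simp only [← Finset.sum_neg_distrib, ← Real.sin_neg, neg_sub]
  linarith

lemma sum_eq_zero_of_mean_eq_zero {N : ℕ} (hN : 0 < N) {x : Fin N → ℝ} (hx : mean x = 0) :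
    ∑ i, x i = 0 := by
  have hN' : (N : ℝ) ≠ 0 := by positivity
  simpa [mean, hN'] using hx

lemma sum_force {N : ℕ} (hN : 0 < N) (K : ℝ) {Ω : Fin N → ℝ} (hΩ : mean Ω = 0)
    (θ : Fin N → ℝ) : ∑ i, force K Ω θ i = 0 := by
  simp only [force, Finset.sum_add_distrib, ← Finset.mul_sum, sum_sum_sin_sub,
    sum_eq_zero_of_mean_eq_zero hN hΩ, mul_zero, add_zero]

/-- The product of the increments of the identity and of sine is positive on `(-π/2, π/2)` off the
diagonal. -/
lemma sub_mul_sin_sub_sin_pos {a b : ℝ} (ha : |a| < Real.pi / 2) (hb : |b| < Real.pi / 2)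
    (hab : a ≠ b) : 0 < (a - b) * (Real.sin a - Real.sin b) := by
  have ha' := abs_lt.1 ha
  have hb' := abs_lt.1 hb
  rcases lt_or_gt_of_ne hab with h | h
  · have := Real.sin_lt_sin_of_lt_of_le_pi_div_two (by linarith) hb'.2.le h
    exact mul_pos_of_neg_of_neg (by linarith) (by linarith)
  · have := Real.sin_lt_sin_of_lt_of_le_pi_div_two (by linarith) ha'.2.le h
    exact mul_pos (by linarith) (by linarith)

/-- Phase-locked states of diameter less than `π / 2` are unique up to a phase shift. -/
theorem IsPhaseLocked.congruent {N : ℕ} (hN : 0 < N) {K : ℝ} (hK : 0 < K) {Ω θ θ' : Fin N → ℝ}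
    (h : IsPhaseLocked K Ω θ) (h' : IsPhaseLocked K Ω θ')
    (hd : diam θ < Real.pi / 2) (hd' : diam θ' < Real.pi / 2) : Congruent θ θ' := by
  have hKN : K / (N : ℝ) ≠ 0 := by positivity
  set s : Fin N → Fin N → ℝ := fun i j => Real.sin (θ j - θ i) - Real.sin (θ' j - θ' i) with hs
  set d : Fin N → ℝ := fun i => θ i - θ' i with hd_def
  have hrow : ∀ i, ∑ j, s i j = 0 := fun i => by
    have h1 := h i
    have h2 := h' i
    simp only [force] at h1 h2
    have : K / (N : ℝ) * ∑ j, s i j = 0 := by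
      simp only [hs, Finset.sum_sub_distrib, mul_sub]
      linarith
    exact (mul_eq_zero.1 this).resolve_left hKN
  have hanti : ∀ i j, s j i = -s i j := fun i j => by
    simp only [hs]
    rw [← neg_sub (θ j), ← neg_sub (θ' j), Real.sin_neg, Real.sin_neg]
    ring
  have hz : ∑ i, ∑ j, d i * s i j = 0 := by simp [← Finset.mul_sum, hrow]
  have hz' : ∑ i, ∑ j, d j * s i j = 0 := by
    rw [Finset.sum_comm, ← neg_eq_zero, ← hz]
    simp only [← Finset.sum_neg_distrib]
    refine Finset.sum_congr rfl fun i _ => Finset.sum_congr rfl fun j _ => ?_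
    rw [hanti i j, mul_neg, neg_neg]
  have hsum : ∑ i, ∑ j, (d j - d i) * s i j = 0 := by
    simp only [sub_mul, Finset.sum_sub_distrib, hz, hz', sub_zero]
  have hlt : ∀ i j, |θ j - θ i| < Real.pi / 2 := fun i j => (abs_sub_le_diam θ j i).trans_lt hd
  have hlt' : ∀ i j, |θ' j - θ' i| < Real.pi / 2 :=
    fun i j => (abs_sub_le_diam θ' j i).trans_lt hd'
  have hpos : ∀ i j, d j ≠ d i → 0 < (d j - d i) * s i j := fun i j hij => by
    -- Taken at `a = θ j - θ i` and `b = θ' j - θ' i`, for which `a - b = d j - d i`.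
    have := sub_mul_sin_sub_sin_pos (hlt i j) (hlt' i j) fun e => hij (by
      simp only [hd_def]; linarith)
    convert this using 2
    simp only [hd_def]; ring
  have hnonneg : ∀ i j, 0 ≤ (d j - d i) * s i j := fun i j => by
    by_cases hij : d j = d i
    · simp [hij]
    · exact (hpos i j hij).le
  refine ⟨d ⟨0, hN⟩, funext fun j => ?_⟩
  by_contra hj
  have h1 := (Finset.sum_eq_zero_iff_of_nonneg fun i _ =>
    Finset.sum_nonneg fun j _ => hnonneg i j).1 hsum ⟨0, hN⟩ (Finset.mem_univ _)
  have h2 := (Finset.sum_eq_zero_iff_of_nonneg fun j _ => hnonneg _ j).1 h1 j (Finset.mem_univ _)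
  exact (hpos _ j hj).ne' h2

lemma eq_of_hasDerivAt_zero {f : ℝ → ℝ} {a t : ℝ} (hf : ContinuousOn f (Set.Ici a))
    (hf' : ∀ s, a < s → HasDerivAt f 0 s) (ht : a ≤ t) : f t = f a := by
  rcases ht.eq_or_lt with rfl | ht
  · rfl
  obtain ⟨c, -, hc⟩ := exists_hasDerivAt_eq_slope f (fun _ => 0) ht
    (hf.mono Set.Icc_subset_Ici_self) fun x hx => hf' x hx.1
  have : t - a ≠ 0 := (sub_pos.2 ht).ne'
  field_simp at hc
  linarith

/-- If `m y + x` is constant in time, where `y = x'`, then `x` converges to this constant. -/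
lemma tendsto_of_hasDerivAt_relaxation {m : ℝ} (hm : 0 < m) {x y : ℝ → ℝ} {c : ℝ}
    (hx : ContinuousOn x (Set.Ici 0)) (hx' : ∀ t, 0 < t → HasDerivAt x (y t) t)
    (hc : ∀ t, 0 ≤ t → m * y t + x t = c) : Filter.Tendsto x Filter.atTop (nhds c) := by
  -- Integrating factor: `m x' + x = c` makes `(x - c) exp (t / m)` constant.
  have hconst : ∀ t, 0 ≤ t → (x t - c) * Real.exp (t / m) = (x 0 - c) * Real.exp (0 / m) := by
    intro t ht
    refine eq_of_hasDerivAt_zero (f := fun s => (x s - c) * Real.exp (s / m))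
      (by fun_prop) (fun s hs => ?_) ht
    have hexp : HasDerivAt (fun s => Real.exp (s / m)) (Real.exp (s / m) * (1 / m)) s :=
      ((hasDerivAt_id s).div_const m).exp
    refine (((hx' s hs).sub_const c).mul hexp).congr_deriv ?_
    rw [← hc s hs.le]
    field_simp
    ring
  have hlim : Filter.Tendsto (fun t => c + (x 0 - c) * Real.exp (-(t / m))) Filter.atTop
      (nhds (c + (x 0 - c) * 0)) :=
    ((Real.tendsto_exp_neg_atTop_nhds_zero.comp
      (Filter.tendsto_id.atTop_div_const hm)).const_mul _).const_add _
  rw [mul_zero, add_zero] at hlim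
  refine hlim.congr' ?_
  filter_upwards [Filter.eventually_ge_atTop 0] with t ht
  have h := hconst t ht
  rw [zero_div, Real.exp_zero, mul_one] at h
  rw [← h, mul_assoc, ← Real.exp_add, add_neg_cancel, Real.exp_zero]
  ring

/-- The sum of the phases of an emergent state is determined by the initial data. -/
lemma EmergesFrom.sum_eq {N : ℕ} (hN : 0 < N) {m K : ℝ} (hm : 0 < m) {Ω : Fin N → ℝ}
    (hΩ : mean Ω = 0) {θ₀ ω₀ θinf : Fin N → ℝ} (h : EmergesFrom m K Ω θ₀ ω₀ θinf) :
    ∑ i, θinf i = m * ∑ i, ω₀ i + ∑ i, θ₀ i := by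
  obtain ⟨-, θ, ω, hsol, hlim⟩ := h
  have hθ : ContinuousOn (fun t => ∑ i, θ t i) (Set.Ici 0) :=
    continuousOn_finsetSum _ fun i _ => continuousOn_pi.1 hsol.continuousOn_phase i
  have hω : ContinuousOn (fun t => ∑ i, ω t i) (Set.Ici 0) :=
    continuousOn_finsetSum _ fun i _ => continuousOn_pi.1 hsol.continuousOn_freq i
  have hθ' : ∀ t, 0 < t → HasDerivAt (fun t => ∑ i, θ t i) (∑ i, ω t i) t := fun t ht =>
    HasDerivAt.fun_sum fun i _ => hsol.hasDerivAt_phase t ht i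
  have hω' : ∀ t, 0 < t → HasDerivAt (fun t => ∑ i, ω t i)
      (∑ i, (1 / m) * (-ω t i + force K Ω (θ t) i)) t := fun t ht =>
    HasDerivAt.fun_sum fun i _ => hsol.hasDerivAt_freq t ht i
  have hcons : ∀ t, 0 ≤ t →
      m * ∑ i, ω t i + ∑ i, θ t i = m * ∑ i, ω₀ i + ∑ i, θ₀ i := fun t ht => by
    rw [← hsol.phase_zero, ← hsol.freq_zero]
    refine eq_of_hasDerivAt_zero (f := fun t => m * ∑ i, ω t i + ∑ i, θ t i)
      ((hω.const_mul m).add hθ) (fun s hs => ?_) ht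
    refine (((hω' s hs).const_mul m).add (hθ' s hs)).congr_deriv ?_
    rw [← Finset.mul_sum, Finset.sum_add_distrib, sum_force hN K hΩ, Finset.sum_neg_distrib]
    field_simp
    ring
  have hsum : Filter.Tendsto (fun t => ∑ i, θ t i) Filter.atTop (nhds (∑ i, θinf i)) :=
    tendsto_finsetSum _ fun i _ => tendsto_pi_nhds.1 hlim i
  -- Convergence of the frequencies need not be known: the scalar equation for `∑ θ` already fixes
  -- its limit.
  exact tendsto_nhds_unique hsum (tendsto_of_hasDerivAt_relaxation hm hθ hθ' hcons)

end Kuramoto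

theorem mainTheorem2 {N : ℕ} (hN : 0 < N) (m K : ℝ) (hm : 0 < m) (hK : 0 < K)
    (Ω : Fin N → ℝ) (hΩ : Kuramoto.mean Ω = 0) :
    (∀ θ θ' : Fin N → ℝ,
      Kuramoto.IsPhaseLocked K Ω θ → Kuramoto.IsPhaseLocked K Ω θ' →
      Kuramoto.diam θ < Real.pi / 2 → Kuramoto.diam θ' < Real.pi / 2 →
      Kuramoto.Congruent θ θ') ∧
    (∀ θ₀ ω₀ θ₀' ω₀' θinf θinf' : Fin N → ℝ,
      Kuramoto.EmergesFrom m K Ω θ₀ ω₀ θinf →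
      Kuramoto.EmergesFrom m K Ω θ₀' ω₀' θinf' →
      Kuramoto.diam θinf < Real.pi / 2 → Kuramoto.diam θinf' < Real.pi / 2 →
      θinf - θinf' = fun _ =>
        Kuramoto.mean θ₀ - Kuramoto.mean θ₀' + m * (Kuramoto.mean ω₀ - Kuramoto.mean ω₀')) := by
  refine ⟨fun θ θ' h h' hd hd' => h.congruent hN hK h' hd hd', ?_⟩
  intro θ₀ ω₀ θ₀' ω₀' θinf θinf' h h' hd hd'
  obtain ⟨β, hβ⟩ := h.1.congruent hN hK h'.1 hd hd'
  have hN' : (N : ℝ) ≠ 0 := by positivity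
  -- Summing over the oscillators recovers `β` from the two conserved quantities.
  have hsum : ∑ i, θinf i - ∑ i, θinf' i = N * β := by
    rw [← Finset.sum_sub_distrib]
    calc ∑ i, (θinf i - θinf' i) = ∑ _i : Fin N, β :=
          Finset.sum_congr rfl fun i _ => congrFun hβ i
      _ = N * β := by simp
  rw [h.sum_eq hN hm hΩ, h'.sum_eq hN hm hΩ] at hsum
  rw [hβ]
  funext _
  simp only [Kuramoto.mean]
  field_simp
  linarith
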